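/- **Setting.** Let $G=(\mathcal V,\mathcal E)$ be a finite directed graph of agents, $\mathcal I_i$ the set of incoming neighbours of $i$ (other than $i$), $f\ge 0$ an integer, and $\Theta$ a finite set of $m=|\Theta|$ hypotheses with true hypothesis $\theta^*\in\Theta$. Each agent $i$ has a finite signal space $\mathcal S_i$ and, for each $\theta\in\Theta$, a probability distribution $\ell_i(\cdot|\theta)$ on $\mathcal S_i$ with $\ell_i(w|\theta)>0$ for all $w$. In iteration $t\ge1$ agent $i$ observes $s^i_t\sim \ell_i(\cdot|\theta^*)$, and all these signals are independent over $t$ and $i$. An arbitrary set $\mathcal F\subseteq \mathcal V$ with $|\mathcal F|\le f$ consists of Byzantine agents; the others are non-faulty. **BFL rule.** A point $z$ is a *Tverberg point* of a finite family of vectors of $\mathbb R^m$ if the family can be partitioned into $f+1$ parts whose convex hulls all contain $z$. Each non-faulty agent $i$ starts with a strictly positive probability vector $\mu^i_0$ on $\Theta$ (for instance the uniform one). In iteration $t\ge1$: 1. $i$ sends $x^i=\log\mu^i_{t-1}\in\mathbb R^m$ on its outgoing links and receives one vector of $\mathbb R^m$ from each $j\in\mathcal I_i$ (Byzantine agents send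 arbitrary vectors, possibly different ones to different agents and depending on the whole execution); 2. for every subcollection of exactly $(m+1)f+1$ of the $|\mathcal I_i|+1$ vectors available to it (those received and its own), $i$ chooses one Tverberg point; with $Z^i$ the multiset of chosen points, $\eta^i_t=\frac{1}{1+|Z^i|}\bigl(x^i+\sum_{z\in Z^i}z\bigr)$; 3. $i$ observes $s_t^i$ and sets, for all $\theta\in\Theta$, $$\mu^i_t(\theta)=\frac{\ell_i(s^i_{1,t}|\theta)\,e^{\eta^i_t(\theta)}}{\sum_{\theta'\in\Theta}\ell_i(s^i_{1,t}|\theta')\,e^{\eta^i_t(\theta')}},\qquad \ell_i(s^i_{1,t}|\theta)=\prod_{r=1}^t\ell_i(s^i_r|\theta).$$ **Assumption.** An *$m$-dimensional reduced graph* of $G$ is a graph obtained by choosing a set $F\subseteq\mathcal V$ of at most $f$ nodes (any set that may be faulty), removing $F$ with all incident links, and then removing, at each remaining node, up to $mf$ further incoming links. A *source component* is a strongly connected component without incoming links from outside it. Assume that every $m$-dimensional reduced graph $\mathcal H$ has a unique source component $\mathcal S_{\mathcal H}$ and that, for every $\theta\ne\theta^*$, $$\sum_{j\in\mathcal S_{\mathcal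 H}}D\bigl(\ell_j(\cdot|\theta^*)\,\|\,\ell_j(\cdot|\theta)\bigr)\neq 0,$$ where $D$ is the Kullback–Leibler divergence. Let $C_1$ be the minimum of these sums over all $m$-dimensional reduced graphs $\mathcal H$ and all $\theta\neq\theta^*$. **Theorem.** There is a constant $\kappa>0$ depending only on $G$, $f$ and $\Theta$ such that, under the Assumption, for every non-faulty agent $i$ and every $\theta\ne\theta^*$: $C_1>0$; almost surely $\mu_t^i(\theta)\to0$ as $t\to\infty$; and the log-ratio $\psi^i_t(\theta,\theta^*)=\log\frac{\mu^i_t(\theta)}{\mu^i_t(\theta^*)}$ almost surely tends to $-\infty$ at (at least) a quadratic rate: almost surely, for all sufficiently large $t$, $$\psi^i_t(\theta,\theta^*)\le-\kappa\,C_1\,t^2 .$$ -/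

import Mathlib

open MeasureTheory ProbabilityTheory Filter Topology

namespace BFL

/-! ### Reduced graphs and source components -/

/-- `C` is a strongly connected component of the digraph `H`: the class of some node `v` under
mutual reachability. -/
def IsStrongComponent {W : Type*} (H : Digraph W) (C : Finset W) : Prop :=
  ∃ v, ∀ u, u ∈ C ↔ Relation.ReflTransGen H.Adj u v ∧ Relation.ReflTransGen H.Adj v u

/-- A source component: a strongly connected component with no incoming link from outside. -/
def IsSourceComponent {W : Type*} (H : Digraph W) (C : Finset W) : Prop :=
  IsStrongComponent H C ∧ ∀ u v, u ∉ C → v ∈ C → ¬ H.Adj u v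

/-- `H` is obtained from `G` by deleting the nodes in `F` with all links incident on them and
then deleting, at every remaining node, at most `k` further incoming links. (`G.Adj u v` means
that there is a link from `u` to `v`.) For the `m`-dimensional reduced graphs `k = m * f`. -/
def IsReducedGraph {V : Type*} (G : Digraph V) (k : ℕ) (F : Finset V)
    (H : Digraph {v // v ∉ F}) : Prop :=
  (∀ u v, H.Adj u v → G.Adj u v) ∧
    ∀ v : {v // v ∉ F}, Set.ncard {u : {v // v ∉ F} | G.Adj u v ∧ ¬ H.Adj u v} ≤ k

/-- Every `m`-dimensional reduced graph of `G`, for every set `F` of at most `f` nodes that may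
be faulty, contains a unique source component. -/
def UniqueSource {V : Type*} (G : Digraph V) (f m : ℕ) : Prop :=
  ∀ F : Finset V, F.card ≤ f → ∀ H : Digraph {v // v ∉ F}, IsReducedGraph G (m * f) F H →
    ∃! C : Finset {v // v ∉ F}, IsSourceComponent H C

/-! ### Signals -/

/-- `ℓ i θ` is, for every agent `i` and hypothesis `θ`, a probability distribution on the finite
signal space `S i` whose support is the whole space. -/
structure IsSignalModel {V Θ : Type*} {S : V → Type*} [∀ i, Fintype (S i)]
    (ℓ : ∀ i, Θ → S i → ℝ) : Prop where
  pos : ∀ i θ w, 0 < ℓ i θ w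
  sum_eq_one : ∀ i θ, ∑ w, ℓ i θ w = 1

/-- Kullback–Leibler divergence of two distributions on a finite set. -/
noncomputable def klDivergence {A : Type*} [Fintype A] (p q : A → ℝ) : ℝ :=
  ∑ w, p w * Real.log (p w / q w)

/-- `s (t + 1) i` is the private signal of agent `i` in iteration `t + 1` (the value `s 0` is
not used). Signals are independent across iterations and agents, and those of agent `i` have
distribution `ℓ i θstar`. -/
structure IsSignalProcess {V Θ Ω : Type*} {S : V → Type*}
    [∀ i, MeasurableSpace (S i)] [MeasurableSpace Ω] (P : Measure Ω)
    (ℓ : ∀ i, Θ → S i → ℝ) (θstar : Θ) (s : ℕ → ∀ i, Ω → S i) : Prop where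
  measurable : ∀ t i, Measurable (s (t + 1) i)
  indep : iIndepFun (fun (p : ℕ × V) => s (p.1 + 1) p.2) P
  law : ∀ t i w, P.real {ω | s (t + 1) i ω = w} = ℓ i θstar w

/-- The network and identifiability assumption: all reduced graphs of dimension `m = |Θ|` have
a unique source component, whose agents can together tell `θstar` from each `θ ≠ θstar`. -/
structure Assumption {V Θ : Type*} [Fintype Θ] {S : V → Type*} [∀ i, Fintype (S i)]
    (G : Digraph V) (f : ℕ) (ℓ : ∀ i, Θ → S i → ℝ) (θstar : Θ) : Prop where
  unique_source : UniqueSource G f (Fintype.card Θ)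
  identifiable : ∀ θ, θ ≠ θstar → ∀ F : Finset V, F.card ≤ f → ∀ H : Digraph {v // v ∉ F},
    IsReducedGraph G (Fintype.card Θ * f) F H → ∀ C : Finset {v // v ∉ F},
      IsSourceComponent H C → ∑ j ∈ C, klDivergence (ℓ j θstar) (ℓ j θ) ≠ 0

/-- The least, over all reduced graphs and all `θ ≠ θstar`, of the sum of the divergences
`D(ℓ_j(· | θstar) ‖ ℓ_j(· | θ))` over the agents `j` of a source component. -/
noncomputable def detectionCapability {V Θ : Type*} [Fintype Θ] {S : V → Type*}
    [∀ i, Fintype (S i)] (G : Digraph V) (f : ℕ) (ℓ : ∀ i, Θ → S i → ℝ) (θstar : Θ) : ℝ :=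
  sInf {x : ℝ | ∃ θ, θ ≠ θstar ∧ ∃ F : Finset V, F.card ≤ f ∧ ∃ H : Digraph {v // v ∉ F},
    IsReducedGraph G (Fintype.card Θ * f) F H ∧ ∃ C : Finset {v // v ∉ F},
      IsSourceComponent H C ∧ x = ∑ j ∈ C, klDivergence (ℓ j θstar) (ℓ j θ)}

/-! ### The consensus primitive and the learning rule -/

open Classical in
/-- The incoming neighbours of `i` (other than `i` itself; self-loops play no role). -/
noncomputable def inNeighbors {V : Type*} [Fintype V] (G : Digraph V) (i : V) : Finset V :=
  Finset.univ.filter fun j => j ≠ i ∧ G.Adj j i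

/-- `z` is a Tverberg point of the multiset of vectors `val j`, `j ∈ C`: the index set can be
partitioned into `f + 1` parts (the fibres of `c`) such that `z` lies in the convex hull of the
vectors of each part. (All parts are then nonempty, the convex hull of `∅` being empty.) -/
def IsTverbergPoint {V ι : Type*} (f : ℕ) (C : Finset V) (val : V → ι → ℝ) (z : ι → ℝ) : Prop :=
  ∃ c : V → Fin (f + 1), ∀ k, z ∈ convexHull ℝ (val '' {j | j ∈ C ∧ c j = k})

open Classical in
/-- `y` is a possible output of One-Iter at agent `i` with input `x`, when `i` receives the
vector `r j` from each incoming neighbour `j`. The agent chooses one Tverberg point `z C` for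
every subcollection `C` of `(m + 1) * f + 1` of the vectors available to it (the received ones
and its own), and returns the average of its input and all chosen points. -/
def OneIter {V ι : Type*} [Fintype V] [Fintype ι] (G : Digraph V) (f : ℕ) (i : V)
    (x : ι → ℝ) (r : V → ι → ℝ) (y : ι → ℝ) : Prop :=
  let 𝒞 := (insert i (inNeighbors G i)).powersetCard ((Fintype.card ι + 1) * f + 1)
  ∃ z : Finset V → ι → ℝ,
    (∀ C ∈ 𝒞, IsTverbergPoint f C (fun j => if j = i then x else r j) (z C)) ∧
    y = (1 / (1 + (𝒞.card : ℝ))) • (x + ∑ C ∈ 𝒞, z C)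

/-- Likelihood of the signals observed by agent `i` in iterations `1, …, t`. -/
noncomputable def likelihood {V Θ : Type*} {S : V → Type*} (ℓ : ∀ i, Θ → S i → ℝ)
    (s : ℕ → ∀ i, S i) (t : ℕ) (i : V) (θ : Θ) : ℝ :=
  ∏ r ∈ Finset.Icc 1 t, ℓ i θ (s r i)

/-- One execution of BFL with set `F` of Byzantine agents on the signals `s`. Here `μ t i` is the
belief of agent `i` after iteration `t`, `msg t j i` the vector that `i` receives from `j` in
iteration `t`, and `η t i` the output of One-Iter. Nothing is required of the messages sent by
the agents in `F`, which may differ from one recipient to another. -/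
structure IsExecution {V Θ : Type*} [Fintype V] [Fintype Θ] {S : V → Type*}
    (G : Digraph V) (f : ℕ) (F : Finset V) (ℓ : ∀ i, Θ → S i → ℝ) (s : ℕ → ∀ i, S i)
    (msg : ℕ → V → V → Θ → ℝ) (η μ : ℕ → V → Θ → ℝ) : Prop where
  init_pos : ∀ i, i ∉ F → ∀ θ, 0 < μ 0 i θ
  init_sum : ∀ i, i ∉ F → ∑ θ, μ 0 i θ = 1
  send : ∀ t j, j ∉ F → ∀ i, G.Adj j i → msg (t + 1) j i = fun θ => Real.log (μ t j θ)
  consensus : ∀ t i, i ∉ F →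
    OneIter G f i (fun θ => Real.log (μ t i θ)) (fun j => msg (t + 1) j i) (η (t + 1) i)
  update : ∀ t i, i ∉ F → ∀ θ, μ (t + 1) i θ =
    likelihood ℓ s (t + 1) i θ * Real.exp (η (t + 1) i θ) /
      ∑ θ', likelihood ℓ s (t + 1) i θ' * Real.exp (η (t + 1) i θ')

end BFL

namespace BFL

/-! ### Source components of finite digraphs -/

-- Fix the Byzantine set $F$. A Tverberg point lies in the hulls of $f+1$ parts, at least one of
-- them without faulty agents, so it is a convex combination of non-faulty vectors. Weights can be
-- chosen so that, at each non-faulty agent, all but at most $mf$ non-faulty incoming neighbours get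
-- weight at least $\beta$ = `minWeight` (`OneIter.exists_weights`). The links of weight at least
-- $\beta$ thus contain a reduced graph, apart from self-loops.
--
-- Normalisation cancels in log-ratios, hence $\psi_{t+1}=A_t\psi_t+L_{t+1}$ with $A_t$
-- row-stochastic (`IsExecution.exists_averaging`). The likelihood in the update covers all past
-- signals, so the strong law gives $L^j_t\approx-tD_j$: the drift itself grows linearly.
--
-- The source component of each reduced graph has an agent with $D_j\ge\delta=C_1/(N+1)$, where
-- $N=|\mathcal V|$, and reaches every node. Hence any proper set containing all such agents has a
-- heavy link leaving it. The graphs vary with $t$, but the set of agents that have felt a drop of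
-- order $t$ gains a member at each step, so within $N+1$ steps everybody drops by order
-- $\beta^N\delta t$ (`eventually_le_of_averaging`). Summing over blocks of $N+1$ steps gives $t^2$
-- (`eventually_le_neg_sq`).

theorem exists_isSourceComponent_reaching {W : Type*} [Finite W] (H : Digraph W) (v : W) :
    ∃ C : Finset W, IsSourceComponent H C ∧ C.Nonempty ∧
      ∀ u ∈ C, Relation.ReflTransGen H.Adj u v := by
  classical
  have := Fintype.ofFinite W
  let anc : W → Finset W := fun u => Finset.univ.filter fun x => Relation.ReflTransGen H.Adj x u
  -- Choose an ancestor of `v` with fewest ancestors: a link entering its class from outside would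
  -- start at an ancestor with strictly fewer.
  obtain ⟨u, hu, hmin⟩ := Finset.exists_min_image (anc v) (fun u => (anc u).card)
    ⟨v, by simp [anc, Relation.ReflTransGen.refl]⟩
  have huv : Relation.ReflTransGen H.Adj u v := by simpa [anc] using hu
  refine ⟨Finset.univ.filter fun x => Relation.ReflTransGen H.Adj x u ∧
    Relation.ReflTransGen H.Adj u x, ⟨⟨u, by simp⟩, ?_⟩,
    ⟨u, by simp [Relation.ReflTransGen.refl]⟩, ?_⟩
  · intro x y hx hy hxy
    simp only [Finset.mem_filter, Finset.mem_univ, true_and] at hx hy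
    have hxu : Relation.ReflTransGen H.Adj x u := (Relation.ReflTransGen.single hxy).trans hy.1
    have hux : ¬ Relation.ReflTransGen H.Adj u x := fun h => hx ⟨hxu, h⟩
    have hlt : (anc x).card < (anc u).card := by
      refine Finset.card_lt_card ⟨fun z hz => ?_, fun h => hux ?_⟩
      · simp only [anc, Finset.mem_filter, Finset.mem_univ, true_and] at hz ⊢
        exact hz.trans hxu
      · have : u ∈ anc x := h (by simp [anc, Relation.ReflTransGen.refl])
        simpa [anc] using this
    exact absurd (hmin x (by simpa [anc] using hxu.trans huv)) (not_le.mpr hlt)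
  · intro x hx
    simp only [Finset.mem_filter, Finset.mem_univ, true_and] at hx
    exact hx.1.trans huv

/-- Some source component reaches `v`; by uniqueness it is `C`. -/
theorem UniqueSource.reaches {V : Type*} [Finite V] {G : Digraph V} {f m : ℕ}
    (hG : UniqueSource G f m) {F : Finset V} (hF : F.card ≤ f) {H : Digraph {v // v ∉ F}}
    (hH : IsReducedGraph G (m * f) F H) {C : Finset {v // v ∉ F}} (hC : IsSourceComponent H C)
    {u : {v // v ∉ F}} (hu : u ∈ C) (v : {v // v ∉ F}) : Relation.ReflTransGen H.Adj u v := by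
  obtain ⟨C', hC', -, hreach⟩ := exists_isSourceComponent_reaching H v
  rw [(hG F hF H hH).unique hC hC'] at hu
  exact hreach u hu

/-- A set closed under outgoing links that contains a node reaching everything is everything. -/
theorem exists_adj_leaving {W : Type*} (H : Digraph W) {X : Finset W} {u v : W} (hu : u ∈ X)
    (hv : v ∉ X) (h : Relation.ReflTransGen H.Adj u v) : ∃ x ∈ X, ∃ y ∉ X, H.Adj x y := by
  by_contra! hX
  refine hv ?_
  induction h with
  | refl => exact hu
  | tail _ hyz ih =>
    by_contra hz
    exact hX _ (ih fun h => hX _ h _ hz hyz) _ hz hyz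

/-- Two nodes, one of which is isolated from the others, cannot lie in a graph with a unique
source component. -/
theorem not_unique_of_isolated {W : Type*} [Finite W] (H : Digraph W) {i j : W} (hij : i ≠ j)
    (hi : ∀ u v, H.Adj u v → (u = i ↔ v = i)) :
    ¬ ∃! C : Finset W, IsSourceComponent H C := by
  rintro hC
  have key : ∀ u v, Relation.ReflTransGen H.Adj u v → (u = i ↔ v = i) := by
    intro u v h
    induction h with
    | refl => rfl
    | tail _ hyz ih => exact ih.trans (hi _ _ hyz)
  obtain ⟨C, hCs, ⟨u, hu⟩, hCr⟩ := exists_isSourceComponent_reaching H i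
  obtain ⟨C', hCs', -, hCr'⟩ := exists_isSourceComponent_reaching H j
  have hu' := hu
  rw [hC.unique hCs hCs'] at hu'
  have h1 := (key _ _ (hCr u hu)).2 rfl
  exact hij ((key _ _ (hCr' u hu')).1 h1).symm

-- Lower bound on in-degrees

theorem mem_inNeighbors {V : Type*} [Fintype V] {G : Digraph V} {i j : V} :
    j ∈ inNeighbors G i ↔ j ≠ i ∧ G.Adj j i := by
  simp [inNeighbors]

/-- Under the network assumption every agent has enough incoming neighbours for the consensus
primitive to combine at least one subcollection. -/
theorem UniqueSource.le_card_inNeighbors {V : Type*} [Fintype V] {G : Digraph V} {f m : ℕ}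
    (hm : 1 ≤ m) (hG : UniqueSource G f m) (i : V) : (m + 1) * f ≤ (inNeighbors G i).card := by
  classical
  by_contra! hlt
  have hf : 1 ≤ f := by
    by_contra! h
    obtain rfl : f = 0 := by omega
    simp at hlt
  have hiN : i ∉ inNeighbors G i := fun h => (mem_inNeighbors.1 h).1 rfl
  -- Deleting up to `f` of the too few in-neighbours leaves at most `m * f` links into `i`, which a
  -- reduced graph may drop.
  obtain ⟨F, hFN, hFc⟩ := Finset.exists_subset_card_eq
    (min_le_right f (inNeighbors G i).card)
  have hFf : F.card ≤ f := hFc ▸ min_le_left _ _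
  have hiF : i ∉ F := fun h => hiN (hFN h)
  by_cases hj : ∃ j, j ∉ F ∧ j ≠ i
  · obtain ⟨j, hjF, hji⟩ := hj
    -- Cut `i` off in both directions; every other node loses at most its link from `i`, and `1 ≤ m
    -- * f`.
    let H : Digraph {v // v ∉ F} := ⟨fun u v => G.Adj u v ∧ (u = ⟨i, hiF⟩ ↔ v = ⟨i, hiF⟩)⟩
    refine not_unique_of_isolated H (i := ⟨i, hiF⟩) (j := ⟨j, hjF⟩)
      (fun h => hji (congrArg Subtype.val h).symm) (fun u v h => h.2)
      (hG F hFf H ⟨fun u v h => h.1, fun v => ?_⟩)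
    by_cases hv : v = ⟨i, hiF⟩
    · subst hv
      have hsub : Subtype.val '' {u : {v // v ∉ F} | G.Adj u i ∧ ¬ H.Adj u ⟨i, hiF⟩} ⊆
          ((inNeighbors G i \ F : Finset V) : Set V) := by
        rintro _ ⟨u, ⟨hu1, hu2⟩, rfl⟩
        have : (u : V) ≠ i := fun h => hu2 ⟨hu1, by simp [Subtype.ext_iff, h]⟩
        simp [mem_inNeighbors, this, hu1, u.2]
      rw [← Set.ncard_image_of_injective _ Subtype.val_injective]
      refine (Set.ncard_le_ncard hsub (Finset.finite_toSet _)).trans ?_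
      rw [Set.ncard_coe_finset, Finset.card_sdiff_of_subset hFN, hFc]
      rcases le_total f (inNeighbors G i).card with h | h
      · rw [min_eq_left h]
        have : (m + 1) * f = m * f + f := by ring
        omega
      · rw [min_eq_right h]; simp
    · have hsub : {u : {v // v ∉ F} | G.Adj u v ∧ ¬ H.Adj u v} ⊆ {⟨i, hiF⟩} := by
        rintro u ⟨hu1, hu2⟩
        by_contra hne
        exact hu2 ⟨hu1, iff_of_false hne hv⟩
      refine (Set.ncard_le_ncard hsub).trans ?_
      rw [Set.ncard_singleton]
      exact Nat.mul_pos hm hf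
  · push Not at hj
    have hV : (Finset.univ : Finset V) ⊆ insert i F := fun j _ => by
      by_cases h : j ∈ F
      · simp [h]
      · simp [hj j h]
    have hcard : Fintype.card V ≤ F.card + 1 :=
      (Finset.card_le_card hV).trans (Finset.card_insert_le _ _)
    by_cases hVf : Fintype.card V ≤ f
    -- All nodes may be deleted, and the empty graph has no component.
    · obtain ⟨C, ⟨⟨v, -⟩, -⟩, -⟩ := hG Finset.univ (by simpa using hVf) ⟨fun _ _ => False⟩
        ⟨fun _ _ h => h.elim, fun v => (v.2 (Finset.mem_univ _)).elim⟩
      exact v.2 (Finset.mem_univ _)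
    · have : Nontrivial V := Fintype.one_lt_card_iff_nontrivial.1 (by omega)
      obtain ⟨j, hji⟩ := exists_ne i
      -- Here there are exactly `f + 1` nodes, so every link between distinct nodes may be dropped.
      let H : Digraph {v // v ∉ (∅ : Finset V)} := ⟨fun u v => G.Adj u v ∧ u = v⟩
      refine not_unique_of_isolated H (i := ⟨i, by simp⟩) (j := ⟨j, by simp⟩)
        (fun h => hji (congrArg Subtype.val h).symm) (fun u v h => by rw [h.2])
        (hG ∅ (by simp) H ⟨fun u v h => h.1, fun v => ?_⟩)
      have hsub : Subtype.val '' {u : {v // v ∉ (∅ : Finset V)} | G.Adj u v ∧ ¬ H.Adj u v} ⊆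
          ((Finset.univ.erase (v : V) : Finset V) : Set V) := by
        rintro _ ⟨u, ⟨hu1, hu2⟩, rfl⟩
        have : (u : V) ≠ v := fun h => hu2 ⟨hu1, Subtype.ext h⟩
        simp [this]
      rw [← Set.ncard_image_of_injective _ Subtype.val_injective]
      refine (Set.ncard_le_ncard hsub (Finset.finite_toSet _)).trans ?_
      rw [Set.ncard_coe_finset, Finset.card_erase_of_mem (Finset.mem_univ _), Finset.card_univ]
      have : f ≤ m * f := Nat.le_mul_of_pos_left f hm
      omega

/-! ### The consensus primitive as a weighted average of non-faulty inputs -/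

/-- If `B` misses at most `f` elements of `C`, some part of a partition of `C` into `f + 1`
parts lies inside `B`. -/
theorem exists_part_subset {V : Type*} [DecidableEq V] {f : ℕ} {C B : Finset V}
    (hB : (C \ B).card ≤ f) (c : V → Fin (f + 1)) : ∃ k, ∀ j ∈ C, c j = k → j ∈ B := by
  by_contra! h
  -- One escaping element per part would give `f + 1` distinct elements of `C \ B`.
  choose g hgC hgc hgB using h
  have hinj : Function.Injective g := fun a b hab => by rw [← hgc a, ← hgc b, hab]
  have := Finset.card_le_card_of_injOn (s := Finset.univ) (t := C \ B) g
    (fun k _ => by simp [hgC k, hgB k]) hinj.injOn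
  simp at this
  omega

theorem exists_weights_of_mem_convexHull {V ι : Type*} [Fintype V] [DecidableEq V]
    {S : Finset V} {x : V → ι → ℝ} {z : ι → ℝ} (hz : z ∈ convexHull ℝ (x '' (S : Set V))) :
    ∃ w : V → ℝ, (∀ j, 0 ≤ w j) ∧ (∀ j, j ∉ S → w j = 0) ∧ ∑ j, w j = 1 ∧
      z = ∑ j, w j • x j := by
  obtain ⟨κ, _, w, p, hw0, hw1, hp, rfl⟩ := mem_convexHull_iff_exists_fintype.1 hz
  -- Several agents may hold the same vector: assign each point to one agent and add up the weights
  -- assigned to it.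
  choose g hgS hgp using hp
  refine ⟨fun j => ∑ k with g k = j, w k, fun j => Finset.sum_nonneg fun k _ => hw0 k,
    fun j hj => Finset.sum_eq_zero fun k hk => ?_, ?_, ?_⟩
  · exact absurd ((Finset.mem_filter.1 hk).2 ▸ hgS k) hj
  · rw [← hw1, Finset.sum_fiberwise]
  · rw [← Finset.sum_fiberwise Finset.univ g]
    refine Finset.sum_congr rfl fun j _ => ?_
    rw [Finset.sum_smul]
    refine Finset.sum_congr rfl fun k hk => ?_
    rw [← hgp k, (Finset.mem_filter.1 hk).2]

/-- A Tverberg point of `C` is a weighted average of the non-faulty vectors in which every set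
`B ⊆ C \ F` missing at most `f` elements of `C` has a member of non-negligible weight. -/
theorem IsTverbergPoint.exists_weights {V ι : Type*} [Fintype V] [DecidableEq V] {f : ℕ}
    {F C : Finset V} (hF : F.card ≤ f) {x val : V → ι → ℝ} (hval : ∀ j ∈ C, j ∉ F → val j = x j)
    {z : ι → ℝ} (hz : IsTverbergPoint f C val z) :
    ∃ w : V → ℝ, (∀ j, 0 ≤ w j) ∧ (∀ j ∈ F, w j = 0) ∧ ∑ j, w j = 1 ∧ z = ∑ j, w j • x j ∧
      ∀ B : Finset V, Disjoint B F → (C \ B).card ≤ f →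
        ∃ j ∈ B, 1 / (((f : ℝ) + 1) * (Fintype.card V + 1)) ≤ w j := by
  obtain ⟨c, hc⟩ := hz
  let part : Fin (f + 1) → Finset V := fun k => C.filter fun j => c j = k
  let K : Finset (Fin (f + 1)) := Finset.univ.filter fun k => Disjoint (part k) F
  have hw : ∀ k ∈ K, ∃ w : V → ℝ, (∀ j, 0 ≤ w j) ∧ (∀ j, j ∉ part k → w j = 0) ∧
      ∑ j, w j = 1 ∧ z = ∑ j, w j • x j := by
    intro k hk
    refine exists_weights_of_mem_convexHull ?_
    have hkF : Disjoint (part k) F := by simpa [K] using hk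
    have : val '' {j | j ∈ C ∧ c j = k} = x '' (part k : Set V) := by
      have hs : {j | j ∈ C ∧ c j = k} = (part k : Set V) := by ext; simp [part]
      rw [hs]
      refine Set.image_congr fun j hj => hval j (Finset.mem_filter.1 hj).1 ?_
      exact Finset.disjoint_left.1 hkF hj
    exact this ▸ hc k
  choose! w hw0 hwpart hw1 hwz using hw
  have hKne : K.Nonempty := by
    obtain ⟨k, hk⟩ := exists_part_subset (C := C) (B := C \ F) (f := f)
      ((Finset.card_le_card (by intro; simp)).trans hF) c
    refine ⟨k, ?_⟩
    simp only [K, part, Finset.mem_filter, Finset.mem_univ, true_and]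
    refine Finset.disjoint_left.2 fun j hj => ?_
    have hj' := Finset.mem_filter.1 hj
    exact (Finset.mem_sdiff.1 (hk j hj'.1 hj'.2)).2
  have hKpos : (0 : ℝ) < K.card := by exact_mod_cast hKne.card_pos
  -- The weights must serve all `B` at once, so average uniformly over all fault-free parts.
  refine ⟨fun j => (K.card : ℝ)⁻¹ * ∑ k ∈ K, w k j, fun j => ?_, fun j hj => ?_, ?_, ?_, ?_⟩
  · exact mul_nonneg (inv_nonneg.2 hKpos.le) (Finset.sum_nonneg fun k hk => hw0 k hk j)
  · dsimp only
    rw [Finset.sum_eq_zero, mul_zero]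
    intro k hk
    refine hwpart k hk j fun h => ?_
    exact Finset.disjoint_left.1 (by simpa [K] using hk) h hj
  · rw [← Finset.mul_sum, Finset.sum_comm, Finset.sum_congr rfl hw1]
    simp [hKpos.ne']
  · simp_rw [mul_smul, ← Finset.smul_sum, Finset.sum_smul]
    rw [Finset.sum_comm, ← Finset.sum_congr rfl hwz]
    simp only [Finset.sum_const, ← Nat.cast_smul_eq_nsmul ℝ, smul_smul]
    rw [inv_mul_cancel₀ hKpos.ne', one_smul]
  · intro B hBF hBf
    obtain ⟨k, hk⟩ := exists_part_subset hBf c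
    have hpB : part k ⊆ B := fun j hj => hk j (Finset.mem_filter.1 hj).1 (Finset.mem_filter.1 hj).2
    have hkK : k ∈ K := by simpa [K] using hBF.mono_left hpB
    -- Pigeonhole on weights of sum 1; the `+ 1` makes the contradiction strict.
    obtain ⟨j, hj⟩ : ∃ j, 1 / ((Fintype.card V : ℝ) + 1) ≤ w k j := by
      by_contra! h
      have h1 : ∑ j, w k j ≤ ∑ _j : V, 1 / ((Fintype.card V : ℝ) + 1) :=
        Finset.sum_le_sum fun j _ => (h j).le
      rw [hw1 k hkK] at h1
      simp only [Finset.sum_const, Finset.card_univ, nsmul_eq_mul] at h1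
      rw [mul_one_div, le_div_iff₀ (by positivity)] at h1
      linarith
    refine ⟨j, hpB ?_, ?_⟩
    · by_contra hjp
      rw [hwpart k hkK j hjp] at hj
      have : (0 : ℝ) < 1 / ((Fintype.card V : ℝ) + 1) := by positivity
      linarith
    · have h1 : w k j ≤ ∑ k ∈ K, w k j :=
        Finset.single_le_sum (f := fun k => w k j) (fun k hk => hw0 k hk j) hkK
      have hKf : (K.card : ℝ) ≤ f + 1 := by
        exact_mod_cast (Finset.card_le_univ K).trans (by simp)
      calc 1 / (((f : ℝ) + 1) * (Fintype.card V + 1))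
          = ((f : ℝ) + 1)⁻¹ * (1 / ((Fintype.card V : ℝ) + 1)) := by
            field_simp
        _ ≤ (K.card : ℝ)⁻¹ * ∑ k ∈ K, w k j := by
            gcongr
            exact hj.trans h1

/-- A lower bound, depending only on the number `N` of agents and on `f`, for the weights that
count in the consensus primitive. -/
noncomputable def minWeight (N f : ℕ) : ℝ :=
  1 / ((1 + 2 ^ N) * (((f : ℝ) + 1) * (N + 1)))

theorem minWeight_pos (N f : ℕ) : 0 < minWeight N f := by
  unfold minWeight; positivity

theorem minWeight_le_one (N f : ℕ) : minWeight N f ≤ 1 := by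
  unfold minWeight
  rw [div_le_one (by positivity)]
  have h1 : (1 : ℝ) ≤ 1 + 2 ^ N := by
    have : (0 : ℝ) < 2 ^ N := by positivity
    linarith
  have h2 : (1 : ℝ) ≤ ((f : ℝ) + 1) * (N + 1) :=
    one_le_mul_of_one_le_of_one_le (by simp) (by simp)
  exact one_le_mul_of_one_le_of_one_le h1 h2

/-- If `m * f + 1` non-faulty in-neighbours were light, some subcollection would contain them all
and miss them in only `f` places; its Tverberg point gives one of them substantial weight. -/
theorem OneIter.exists_weights {V ι : Type*} [Fintype V] [Fintype ι] {G : Digraph V} {f : ℕ}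
    (hι : 1 ≤ Fintype.card ι) (hG : UniqueSource G f (Fintype.card ι)) {F : Finset V}
    (hF : F.card ≤ f) {i : V} (hi : i ∉ F) {x r : V → ι → ℝ}
    (hr : ∀ j, j ∉ F → G.Adj j i → r j = x j) {y : ι → ℝ} (h : OneIter G f i (x i) r y) :
    ∃ a : V → ℝ, (∀ j, 0 ≤ a j) ∧ (∀ j ∈ F, a j = 0) ∧ ∑ j, a j = 1 ∧ y = ∑ j, a j • x j ∧
      minWeight (Fintype.card V) f ≤ a i ∧
      {j | j ∉ F ∧ j ∈ inNeighbors G i ∧ a j < minWeight (Fintype.card V) f}.ncard ≤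
        Fintype.card ι * f := by
  classical
  unfold OneIter at h
  obtain ⟨z, hz, hy⟩ := h
  set 𝒞 := (insert i (inNeighbors G i)).powersetCard ((Fintype.card ι + 1) * f + 1) with h𝒞
  have hw : ∀ C ∈ 𝒞, _ := fun C hC => IsTverbergPoint.exists_weights (x := x) hF (by
    intro j hj hjF
    have hjC := (Finset.mem_powersetCard.1 hC).1 hj
    split_ifs with hji
    · rw [hji]
    · rw [Finset.mem_insert, mem_inNeighbors] at hjC
      exact hr j hjF (hjC.resolve_left hji).2) (hz C hC)
  choose! w hw0 hwF hw1 hwz hwB using hw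
  set q : ℝ := 1 / (1 + (𝒞.card : ℝ)) with hq
  have hqpos : 0 < q := by positivity
  have hcard : (𝒞.card : ℝ) ≤ 2 ^ Fintype.card V := by
    have h1 : 𝒞 ⊆ Finset.univ := Finset.subset_univ _
    have h2 := Finset.card_le_card h1
    rw [Finset.card_univ, Fintype.card_finset] at h2
    exact_mod_cast h2
  have hβq : ∀ y : ℝ, 1 / (((f : ℝ) + 1) * (Fintype.card V + 1)) ≤ y →
      minWeight (Fintype.card V) f ≤ q * y := by
    intro y hy
    calc minWeight (Fintype.card V) f = 1 / (1 + 2 ^ Fintype.card V) *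
          (1 / (((f : ℝ) + 1) * (Fintype.card V + 1))) := by
          unfold minWeight; field_simp
      _ ≤ q * y := by
          rw [hq]; gcongr
  have hsum0 : ∀ j, 0 ≤ ∑ C ∈ 𝒞, w C j := fun j => Finset.sum_nonneg fun C hC => hw0 C hC j
  have hind0 : ∀ j, (0 : ℝ) ≤ if j = i then 1 else 0 := fun j => by split_ifs <;> simp
  refine ⟨fun j => q * ((if j = i then 1 else 0) + ∑ C ∈ 𝒞, w C j), fun j => ?_, fun j hj => ?_,
    ?_, ?_, ?_, ?_⟩
  · exact mul_nonneg hqpos.le (add_nonneg (hind0 j) (hsum0 j))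
  · have hji : j ≠ i := fun h => hi (h ▸ hj)
    simp [hji, Finset.sum_eq_zero fun C hC => hwF C hC j hj]
  · rw [← Finset.mul_sum, Finset.sum_add_distrib, Finset.sum_comm, Finset.sum_congr rfl hw1]
    simp [hq]
    field_simp
  · simp_rw [mul_smul, add_smul, ← Finset.smul_sum, Finset.sum_add_distrib, Finset.sum_smul]
    rw [Finset.sum_comm, ← Finset.sum_congr rfl hwz, hy]
    simp
  · refine hβq _ ?_
    rw [if_pos rfl]
    refine le_trans ?_ (le_add_of_nonneg_right (hsum0 i))
    rw [div_le_one (by positivity)]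
    exact one_le_mul_of_one_le_of_one_le (by simp) (by simp)
  · by_contra! hlt
    obtain ⟨L, hL⟩ := (Set.toFinite {j | j ∉ F ∧ j ∈ inNeighbors G i ∧
      q * ((if j = i then 1 else 0) + ∑ C ∈ 𝒞, w C j) < minWeight (Fintype.card V) f}).exists_finset_coe
    rw [← hL, Set.ncard_coe_finset] at hlt
    have hLmem : ∀ j ∈ L, j ∉ F ∧ j ∈ inNeighbors G i ∧
        q * ((if j = i then 1 else 0) + ∑ C ∈ 𝒞, w C j) < minWeight (Fintype.card V) f := by
      intro j hj
      have : j ∈ (L : Set V) := hj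
      rwa [hL] at this
    obtain ⟨B, hBL, hBc⟩ := Finset.exists_subset_card_eq (Nat.succ_le_of_lt hlt)
    have hBsub : B ⊆ insert i (inNeighbors G i) := fun j hj =>
      Finset.mem_insert_of_mem (hLmem j (hBL hj)).2.1
    have hmf : (Fintype.card ι + 1) * f = Fintype.card ι * f + f := by ring
    -- The in-degree bound provides room for this extension, and `C \ B` has exactly `f` elements.
    obtain ⟨C, hBC, hCs, hCc⟩ := Finset.exists_subsuperset_card_eq hBsub
      (n := (Fintype.card ι + 1) * f + 1) (by rw [hBc]; omega) (by
        rw [Finset.card_insert_of_notMem (fun h => (mem_inNeighbors.1 h).1 rfl)]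
        have := hG.le_card_inNeighbors hι i
        omega)
    have hC𝒞 : C ∈ 𝒞 := Finset.mem_powersetCard.2 ⟨hCs, hCc⟩
    obtain ⟨j, hjB, hj⟩ := hwB C hC𝒞 B
      (Finset.disjoint_left.2 fun j hj => (hLmem j (hBL hj)).1)
      (by rw [Finset.card_sdiff_of_subset hBC, hCc, hBc]; omega)
    refine absurd (hLmem j (hBL hjB)).2.2 (not_lt.2 (hβq _ ?_))
    refine hj.trans ?_
    have := Finset.single_le_sum (f := fun C => w C j) (fun C hC => hw0 C hC j) hC𝒞
    linarith [hind0 j]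

/-! ### Averaging dynamics with drift -/

/-- A real family that drops by at least `c * (t + 1)` in every `T` steps (in the sense of upper
bounds) is eventually below a negative multiple of `t ^ 2`. -/
theorem eventually_le_neg_sq {W : Type*} [Finite W] (ψ : ℕ → W → ℝ) {T t₁ : ℕ} (hT : 0 < T)
    {c : ℝ} (hc : 0 < c)
    (hdrop : ∀ t, t₁ ≤ t → ∀ M : ℝ, (∀ i, ψ t i ≤ M) → ∀ i, ψ (t + T) i ≤ M - c * (t + 1)) :
    ∀ᶠ t : ℕ in atTop, ∀ i, ψ t i ≤ -(c / (8 * T)) * (t : ℝ) ^ 2 := by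
  have hT' : (0 : ℝ) < T := by exact_mod_cast hT
  set d : ℝ := c / (8 * T) with hd
  have hdpos : 0 < d := by positivity
  have hdc : c = 8 * T * d := by rw [hd]; field_simp
  -- With `T ≤ u`, the increment of `2 * d * u ^ 2` over `T` steps is at most `c * (u + 1)`. Half of
  -- the quadratic term later absorbs `K`.
  set t₂ := max t₁ T with ht₂
  obtain ⟨K, hK⟩ : ∃ K : ℝ, ∀ r : Fin T, ∀ i,
      ψ (t₂ + r) i + 2 * d * ((t₂ + r : ℕ) : ℝ) ^ 2 ≤ K := by
    obtain ⟨K, hK⟩ := (Set.finite_range fun p : Fin T × W =>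
      ψ (t₂ + p.1) p.2 + 2 * d * ((t₂ + p.1 : ℕ) : ℝ) ^ 2).bddAbove
    exact ⟨K, fun r i => hK ⟨(r, i), rfl⟩⟩
  have hbound : ∀ t, t₂ ≤ t → ∀ i, ψ t i ≤ K - 2 * d * (t : ℝ) ^ 2 := by
    intro t
    induction t using Nat.strong_induction_on with
    | _ t ih =>
      intro ht i
      by_cases h : t < t₂ + T
      · have := hK ⟨t - t₂, by omega⟩ i
        simp only [Nat.add_sub_cancel' ht] at this
        linarith
      · obtain ⟨u, rfl⟩ : ∃ u, t = u + T := ⟨t - T, by omega⟩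
        have hu : t₂ ≤ u := by omega
        have h1 := hdrop u ((le_max_left _ _).trans hu) _ (ih u (by omega) hu) i
        have hTu : (T : ℝ) ≤ u := by exact_mod_cast (le_max_right _ _).trans hu
        push_cast
        refine h1.trans ?_
        rw [hdc]
        have h2 : 0 ≤ T * d * (u - T) :=
          mul_nonneg (mul_nonneg hT'.le hdpos.le) (sub_nonneg.2 hTu)
        have h3 : 0 ≤ T * d := mul_nonneg hT'.le hdpos.le
        have h4 : 0 ≤ T * d * (u : ℝ) := mul_nonneg h3 (Nat.cast_nonneg u)
        nlinarith
  have hlarge : ∀ᶠ t : ℕ in atTop, K ≤ d * (t : ℝ) ^ 2 := by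
    have : Tendsto (fun t : ℕ => d * (t : ℝ) ^ 2) atTop atTop :=
      ((tendsto_pow_atTop two_ne_zero).comp tendsto_natCast_atTop_atTop).const_mul_atTop hdpos
    exact this.eventually_ge_atTop K
  filter_upwards [hlarge, eventually_ge_atTop t₂] with t h1 h2 i
  have := hbound t h2 i
  linarith

/-- A family of agents who repeatedly average and then drift downwards at speed `t * D j`, up to
sublinear noise. If influence spreads from `{j | δ ≤ D j}` to everybody, all go down
quadratically. -/
theorem eventually_le_of_averaging {W : Type*} [Fintype W] {N : ℕ} (hN : Fintype.card W ≤ N)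
    (A : ℕ → W → W → ℝ) {β δ : ℝ} (hβ : 0 < β) (hδ : 0 < δ)
    (hA0 : ∀ t i j, 0 ≤ A t i j) (hA1 : ∀ t i, ∑ j, A t i j = 1) (hdiag : ∀ t i, β ≤ A t i i)
    (D : W → ℝ) (hD : ∀ j, 0 ≤ D j)
    (hgrow : ∀ t (X : Finset W), (∀ j, δ ≤ D j → j ∈ X) → (∃ v, v ∉ X) →
      ∃ u ∈ X, ∃ v ∉ X, β ≤ A t v u)
    (ψ L : ℕ → W → ℝ) (hψ : ∀ t i, ψ (t + 1) i = ∑ j, A t i j * ψ t j + L (t + 1) i)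
    (hL : ∀ j, Tendsto (fun t : ℕ => L t j / t) atTop (𝓝 (-D j))) :
    ∀ᶠ t : ℕ in atTop, ∀ i,
      ψ t i ≤ -(β ^ N * δ / (16 * (N + 1))) * (t : ℝ) ^ 2 := by
  classical
  have hN0 : (0 : ℝ) < N + 1 := by positivity
  set c : ℝ := β ^ N * δ / 2 with hc
  have hcpos : 0 < c := by positivity
  -- Small enough that the noise of `N + 1` steps costs at most `c * (t + 1)`, half of the drop `β ^
  -- N * δ * (t + 1)`.
  set ε : ℝ := c / (N + 1) ^ 2 with hε
  have hεpos : 0 < ε := by positivity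
  have hnoise : ∀ᶠ t : ℕ in atTop, ∀ j, L t j ≤ -(t * D j) + ε * t := by
    rw [eventually_all]
    intro j
    filter_upwards [(hL j).eventually (gt_mem_nhds (show -D j < -D j + ε by linarith)),
      eventually_gt_atTop 0] with t h1 h2
    have ht : (0 : ℝ) < t := by exact_mod_cast h2
    rw [div_lt_iff₀ ht] at h1
    linarith
  obtain ⟨t₁, ht₁⟩ := eventually_atTop.1 hnoise
  have key := eventually_le_neg_sq ψ (T := N + 1) (t₁ := t₁) (Nat.succ_pos N) hcpos ?_
  · have : β ^ N * δ / (16 * (N + 1)) = c / (8 * ((N + 1 : ℕ) : ℝ)) := by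
      rw [hc]; push_cast; field_simp; norm_num
    rwa [this]
  intro t ht M hM
  -- `X` collects the agents already reached by the drop; each further averaging step costs a factor
  -- `β`. Only the drift of the first step is used; later drifts are nonpositive up to noise.
  have hstep : ∀ s : ℕ, s ≤ N → ∃ X : Finset W, (∀ j, δ ≤ D j → j ∈ X) ∧
      ((∀ v, v ∈ X) ∨ s ≤ X.card) ∧
      ∀ i, ψ (t + 1 + s) i ≤ M + (s + 1) * (ε * (t + N + 1)) -
        (if i ∈ X then β ^ s * δ * (t + 1) else 0) := by
    intro s
    induction s with
    | zero =>
      intro _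
      refine ⟨Finset.univ.filter fun j => δ ≤ D j, by simp, Or.inr (Nat.zero_le _), fun i => ?_⟩
      have h1 : ∑ j, A t i j * ψ t j ≤ M := by
        calc ∑ j, A t i j * ψ t j ≤ ∑ j, A t i j * M :=
              Finset.sum_le_sum fun j _ => mul_le_mul_of_nonneg_left (hM j) (hA0 t i j)
          _ = M := by rw [← Finset.sum_mul, hA1, one_mul]
      have h2 := ht₁ (t + 1) (by omega) i
      push_cast at h2 ⊢
      have h3 : ε * (t + 1) ≤ ε * (t + N + 1) := by
        gcongr; linarith [Nat.cast_nonneg (α := ℝ) N]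
      have h4 : (if δ ≤ D i then δ * ((t : ℝ) + 1) else 0) ≤ (t + 1) * D i := by
        split_ifs with h
        · rw [mul_comm]; gcongr
        · have := hD i; positivity
      simp only [add_zero, Finset.mem_filter, Finset.mem_univ, true_and, pow_zero, one_mul,
        zero_add]
      rw [hψ]
      linarith
    | succ s ih =>
      intro hs
      obtain ⟨X, hX, hXc, hXψ⟩ := ih (by omega)
      obtain ⟨Y, hXY, hYc, hYA⟩ : ∃ Y : Finset W, X ⊆ Y ∧ ((∀ v, v ∈ Y) ∨ s + 1 ≤ Y.card) ∧
          ∀ v ∈ Y, ∃ u ∈ X, β ≤ A (t + 1 + s) v u := by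
        by_cases h : ∃ v, v ∉ X
        · obtain ⟨u, hu, v, hv, huv⟩ := hgrow (t + 1 + s) X hX h
          refine ⟨insert v X, Finset.subset_insert _ _, Or.inr ?_, fun x hx => ?_⟩
          · rw [Finset.card_insert_of_notMem hv]
            have := hXc.resolve_left fun h' => hv (h' v)
            omega
          · rcases Finset.mem_insert.1 hx with rfl | hx
            · exact ⟨u, hu, huv⟩
            · exact ⟨x, hx, hdiag _ _⟩
        · push Not at h
          exact ⟨X, subset_rfl, Or.inl h, fun x hx => ⟨x, hx, hdiag _ _⟩⟩
      refine ⟨Y, fun j hj => hXY (hX j hj), hYc, fun i => ?_⟩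
      set M' : ℝ := M + (s + 1) * (ε * (t + N + 1)) with hM'
      have h1 : ∑ j, A (t + 1 + s) i j * ψ (t + 1 + s) j ≤
          M' - ∑ j, A (t + 1 + s) i j * (if j ∈ X then β ^ s * δ * (t + 1) else 0) := by
        calc ∑ j, A (t + 1 + s) i j * ψ (t + 1 + s) j
            ≤ ∑ j, A (t + 1 + s) i j * (M' - (if j ∈ X then β ^ s * δ * (t + 1) else 0)) :=
              Finset.sum_le_sum fun j _ => mul_le_mul_of_nonneg_left (hXψ j) (hA0 _ i j)
          _ = _ := by
              simp_rw [mul_sub]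
              rw [Finset.sum_sub_distrib, ← Finset.sum_mul, hA1, one_mul]
      have hterm : ∀ j, 0 ≤ A (t + 1 + s) i j * (if j ∈ X then β ^ s * δ * ((t : ℝ) + 1) else 0) :=
        fun j => mul_nonneg (hA0 _ _ _) (by split_ifs <;> positivity)
      have h2 : (if i ∈ Y then β ^ (s + 1) * δ * ((t : ℝ) + 1) else 0) ≤
          ∑ j, A (t + 1 + s) i j * (if j ∈ X then β ^ s * δ * (t + 1) else 0) := by
        split_ifs with hi
        · obtain ⟨u, hu, hiu⟩ := hYA i hi
          refine le_trans ?_ (Finset.single_le_sum (fun j _ => hterm j) (Finset.mem_univ u))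
          rw [if_pos hu, pow_succ, mul_comm (β ^ s) β, mul_assoc β, mul_assoc β]
          exact mul_le_mul_of_nonneg_right hiu (by positivity)
        · exact Finset.sum_nonneg fun j _ => hterm j
      have h3 := ht₁ (t + 1 + s + 1) (by omega) i
      have h4 : ε * ((t + 1 + s + 1 : ℕ) : ℝ) ≤ ε * (t + N + 1) := by
        have : ((s + 1 : ℕ) : ℝ) ≤ N := by exact_mod_cast hs
        push_cast at this ⊢
        exact mul_le_mul_of_nonneg_left (by linarith) hεpos.le
      have h5 : 0 ≤ ((t + 1 + s + 1 : ℕ) : ℝ) * D i := mul_nonneg (Nat.cast_nonneg _) (hD i)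
      have h6 : M + (((s + 1 : ℕ) : ℝ) + 1) * (ε * (t + N + 1)) = M' + ε * (t + N + 1) := by
        rw [hM']; push_cast; ring
      rw [h6, ← add_assoc, hψ]
      linarith
  obtain ⟨X, -, hXc, hXψ⟩ := hstep N le_rfl
  have hXall : ∀ v, v ∈ X := hXc.elim id fun h v => by
    rw [(Finset.card_eq_iff_eq_univ X).1 (le_antisymm (Finset.card_le_univ X) (hN.trans h))]
    exact Finset.mem_univ v
  intro i
  have h1 := hXψ i
  rw [if_pos (hXall i)] at h1
  have h2 : ((N : ℝ) + 1) * (ε * (t + N + 1)) ≤ c * (t + 1) := by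
    have : (t : ℝ) + N + 1 ≤ (N + 1) * (t + 1) := by
      have := mul_nonneg (Nat.cast_nonneg (α := ℝ) N) (Nat.cast_nonneg (α := ℝ) t)
      linarith
    calc ((N : ℝ) + 1) * (ε * (t + N + 1)) ≤ (N + 1) * (ε * ((N + 1) * (t + 1))) := by gcongr
      _ = c * (t + 1) := by rw [hε]; field_simp
  have h3 : β ^ N * δ * ((t : ℝ) + 1) = 2 * (c * (t + 1)) := by rw [hc]; ring
  rw [show t + (N + 1) = t + 1 + N by ring]
  linarith

/-! ### Divergences and log-likelihood ratios -/

/-- Gibbs' inequality: `log x ≤ x - 1` bounds each term below by `p w - q w`. -/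
theorem klDivergence_nonneg {A : Type*} [Fintype A] {p q : A → ℝ} (hp : ∀ w, 0 < p w)
    (hq : ∀ w, 0 < q w) (hp1 : ∑ w, p w = 1) (hq1 : ∑ w, q w = 1) : 0 ≤ klDivergence p q := by
  have h : ∑ w, (p w - q w) ≤ klDivergence p q := by
    refine Finset.sum_le_sum fun w _ => ?_
    have h1 := Real.log_le_sub_one_of_pos (div_pos (hq w) (hp w))
    rw [← inv_div, Real.log_inv] at h1
    have h2 : p w * (-Real.log (p w / q w)) ≤ p w * ((p w / q w)⁻¹ - 1) :=
      mul_le_mul_of_nonneg_left h1 (hp w).le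
    have h3 : p w * ((p w / q w)⁻¹ - 1) = q w - p w := by
      have := (hp w).ne'
      have := (hq w).ne'
      field_simp
    linarith
  rwa [Finset.sum_sub_distrib, hp1, hq1, sub_self] at h

theorem detectionCapability_le {V Θ : Type*} [Fintype V] [Fintype Θ] {S : V → Type*}
    [∀ i, Fintype (S i)] {G : Digraph V} {f : ℕ} {ℓ : ∀ i, Θ → S i → ℝ} {θstar θ : Θ}
    (hθ : θ ≠ θstar) {F : Finset V} (hF : F.card ≤ f) {H : Digraph {v // v ∉ F}}
    (hH : IsReducedGraph G (Fintype.card Θ * f) F H) {C : Finset {v // v ∉ F}}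
    (hC : IsSourceComponent H C) (hℓ : IsSignalModel ℓ) :
    detectionCapability G f ℓ θstar ≤ ∑ j ∈ C, klDivergence (ℓ j θstar) (ℓ j θ) := by
  refine csInf_le ⟨0, ?_⟩ ⟨θ, hθ, F, hF, H, hH, C, hC, rfl⟩
  rintro _ ⟨θ, -, F, -, H, -, C, -, rfl⟩
  exact Finset.sum_nonneg fun j _ => klDivergence_nonneg (hℓ.pos j _) (hℓ.pos j _)
    (hℓ.sum_eq_one j _) (hℓ.sum_eq_one j _)

/-- The sums depend only on `θ`, `F` and `C`, so they take finitely many values; `G` itself provides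
one. The infimum is therefore attained, at a nonnegative and nonzero sum. -/
theorem detectionCapability_pos {V Θ : Type*} [Fintype V] [Fintype Θ] {S : V → Type*}
    [∀ i, Fintype (S i)] {G : Digraph V} {f : ℕ} {ℓ : ∀ i, Θ → S i → ℝ} {θstar θ : Θ}
    (hθ : θ ≠ θstar) (hℓ : IsSignalModel ℓ) (hA : Assumption G f ℓ θstar) :
    0 < detectionCapability G f ℓ θstar := by
  set s := {x : ℝ | ∃ θ, θ ≠ θstar ∧ ∃ F : Finset V, F.card ≤ f ∧ ∃ H : Digraph {v // v ∉ F},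
    IsReducedGraph G (Fintype.card Θ * f) F H ∧ ∃ C : Finset {v // v ∉ F},
      IsSourceComponent H C ∧ x = ∑ j ∈ C, klDivergence (ℓ j θstar) (ℓ j θ)} with hs
  have hfin : s.Finite := by
    refine (Set.finite_range fun p : Θ × (Σ F : Finset V, Finset {v // v ∉ F}) =>
      ∑ j ∈ p.2.2, klDivergence (ℓ j θstar) (ℓ j p.1)).subset ?_
    rintro _ ⟨θ, -, F, -, H, -, C, -, rfl⟩
    exact ⟨(θ, ⟨F, C⟩), rfl⟩
  have hne : s.Nonempty := by
    let H : Digraph {v // v ∉ (∅ : Finset V)} := ⟨fun u v => G.Adj u v⟩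
    have hH : IsReducedGraph G (Fintype.card Θ * f) ∅ H := by
      refine ⟨fun u v h => h, fun v => ?_⟩
      have : {u : {v // v ∉ (∅ : Finset V)} | G.Adj u v ∧ ¬ H.Adj u v} = ∅ := by
        ext u; simp [H]
      simp [this]
    obtain ⟨C, hC, -⟩ := hA.unique_source ∅ (by simp) H hH
    exact ⟨_, θ, hθ, ∅, by simp, H, hH, C, hC, rfl⟩
  obtain ⟨θ, hθ, F, hF, H, hH, C, hC, hx⟩ := hne.csInf_mem hfin
  have h : detectionCapability G f ℓ θstar = ∑ j ∈ C, klDivergence (ℓ j θstar) (ℓ j θ) := hx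
  rw [h]
  exact lt_of_le_of_ne (Finset.sum_nonneg fun j _ => klDivergence_nonneg (hℓ.pos j _)
    (hℓ.pos j _) (hℓ.sum_eq_one j _) (hℓ.sum_eq_one j _))
    (hA.identifiable θ hθ F hF H hH C hC).symm

-- Law of large numbers for the likelihoods

theorem log_likelihood_div {V Θ : Type*} {S : V → Type*} [∀ i, Fintype (S i)]
    {ℓ : ∀ i, Θ → S i → ℝ} (hℓ : IsSignalModel ℓ) (s : ℕ → ∀ i, S i) (t : ℕ) (i : V)
    (θ θ' : Θ) : Real.log (likelihood ℓ s t i θ / likelihood ℓ s t i θ') =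
      ∑ r ∈ Finset.range t, Real.log (ℓ i θ (s (r + 1) i) / ℓ i θ' (s (r + 1) i)) := by
  unfold likelihood
  rw [← Finset.prod_div_distrib, Real.log_prod fun r _ =>
    (div_pos (hℓ.pos i θ _) (hℓ.pos i θ' _)).ne', Finset.sum_bij' (fun r _ => r - 1)
    (fun r _ => r + 1)]
  all_goals simp only [Finset.mem_Icc, Finset.mem_range]
  · intros; omega
  · intros; omega
  · intros; omega
  · intros; omega
  · rintro r ⟨h, -⟩; rw [Nat.sub_add_cancel h]

/-- The strong law of large numbers for the log-likelihood ratios. -/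
theorem IsSignalProcess.tendsto_log_likelihood {V Θ Ω : Type*} {S : V → Type*}
    [∀ i, Fintype (S i)] [∀ i, MeasurableSpace (S i)] [∀ i, MeasurableSingletonClass (S i)]
    [MeasurableSpace Ω] {P : Measure Ω} [IsProbabilityMeasure P] {ℓ : ∀ i, Θ → S i → ℝ}
    {θstar : Θ} {s : ℕ → ∀ i, Ω → S i} (hs : IsSignalProcess P ℓ θstar s)
    (hℓ : IsSignalModel ℓ) (i : V) (θ : Θ) :
    ∀ᵐ ω ∂P, Tendsto (fun t : ℕ => Real.log (likelihood ℓ (fun t i => s t i ω) t i θ /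
      likelihood ℓ (fun t i => s t i ω) t i θstar) / t) atTop
      (𝓝 (-klDivergence (ℓ i θstar) (ℓ i θ))) := by
  let g : S i → ℝ := fun w => Real.log (ℓ i θ w / ℓ i θstar w)
  have hg : Measurable g := measurable_of_finite g
  have hid : ∀ t, IdentDistrib (s (t + 1) i) (s (0 + 1) i) P P := by
    intro t
    refine ⟨(hs.measurable t i).aemeasurable, (hs.measurable 0 i).aemeasurable, ?_⟩
    have hprob : ∀ t, IsProbabilityMeasure (P.map (s (t + 1) i)) := fun t =>
      Measure.isProbabilityMeasure_map (hs.measurable t i).aemeasurable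
    have := hprob t
    have := hprob 0
    refine Measure.ext_of_singleton fun w => ?_
    rw [Measure.map_apply (hs.measurable t i) (measurableSet_singleton w),
      Measure.map_apply (hs.measurable 0 i) (measurableSet_singleton w),
      ← ENNReal.toReal_eq_toReal_iff' (measure_ne_top _ _) (measure_ne_top _ _)]
    exact (hs.law t i w).trans (hs.law 0 i w).symm
  have hint : Integrable (fun ω => g (s (0 + 1) i ω)) P := by
    obtain ⟨K, hK⟩ := (Set.finite_range fun w => ‖g w‖).bddAbove
    exact Integrable.of_bound (hg.comp (hs.measurable 0 i)).aestronglyMeasurable K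
      (Filter.Eventually.of_forall fun ω => hK ⟨_, rfl⟩)
  have hmean : ∫ ω, g (s (0 + 1) i ω) ∂P = -klDivergence (ℓ i θstar) (ℓ i θ) := by
    rw [← integral_map (hs.measurable 0 i).aemeasurable hg.aestronglyMeasurable]
    have := Measure.isProbabilityMeasure_map (μ := P) (hs.measurable 0 i).aemeasurable
    rw [integral_fintype (Integrable.of_finite)]
    unfold klDivergence
    rw [← Finset.sum_neg_distrib]
    refine Finset.sum_congr rfl fun w _ => ?_
    rw [map_measureReal_apply (hs.measurable 0 i) (measurableSet_singleton w)]
    have h1 : P.real (s (0 + 1) i ⁻¹' {w}) = ℓ i θstar w := hs.law 0 i w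
    rw [h1, ← inv_div, Real.log_inv, smul_eq_mul]
    ring
  -- Pairwise independence over time of the signals of `i` suffices here.
  have hlaw := strong_law_ae_real (μ := P) (fun t ω => g (s (t + 1) i ω)) hint
    (fun a b hab => (hs.indep.indepFun (i := (a, i)) (j := (b, i))
      (by simpa using hab)).comp hg hg) (fun t => (hid t).comp hg)
  filter_upwards [hlaw] with ω hω
  rw [hmean] at hω
  refine hω.congr fun t => ?_
  rw [log_likelihood_div hℓ]

/-! ### Executions -/

theorem likelihood_pos {V Θ : Type*} {S : V → Type*} [∀ i, Fintype (S i)]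
    {ℓ : ∀ i, Θ → S i → ℝ} (hℓ : IsSignalModel ℓ) (s : ℕ → ∀ i, S i) (t : ℕ) (i : V) (θ : Θ) :
    0 < likelihood ℓ s t i θ :=
  Finset.prod_pos fun _ _ => hℓ.pos i θ _

theorem IsExecution.belief_pos {V Θ : Type*} [Fintype V] [Fintype Θ] {S : V → Type*}
    [∀ i, Fintype (S i)] {G : Digraph V} {f : ℕ} {F : Finset V} {ℓ : ∀ i, Θ → S i → ℝ}
    {s : ℕ → ∀ i, S i} {msg : ℕ → V → V → Θ → ℝ} {η μ : ℕ → V → Θ → ℝ}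
    (h : IsExecution G f F ℓ s msg η μ) (hℓ : IsSignalModel ℓ) (t : ℕ) {i : V} (hi : i ∉ F)
    (θ : Θ) : 0 < μ t i θ := by
  cases t with
  | zero => exact h.init_pos i hi θ
  | succ t =>
    rw [h.update t i hi θ]
    have hpos : ∀ θ, 0 < likelihood ℓ s (t + 1) i θ * Real.exp (η (t + 1) i θ) := fun θ =>
      mul_pos (likelihood_pos hℓ s _ i θ) (Real.exp_pos _)
    exact div_pos (hpos θ) (Finset.sum_pos (fun θ _ => hpos θ) ⟨θ, Finset.mem_univ θ⟩)

theorem IsExecution.belief_sum {V Θ : Type*} [Fintype V] [Fintype Θ] [Nonempty Θ]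
    {S : V → Type*} [∀ i, Fintype (S i)] {G : Digraph V} {f : ℕ} {F : Finset V}
    {ℓ : ∀ i, Θ → S i → ℝ} {s : ℕ → ∀ i, S i} {msg : ℕ → V → V → Θ → ℝ}
    {η μ : ℕ → V → Θ → ℝ} (h : IsExecution G f F ℓ s msg η μ) (hℓ : IsSignalModel ℓ) (t : ℕ)
    {i : V} (hi : i ∉ F) : ∑ θ, μ t i θ = 1 := by
  cases t with
  | zero => exact h.init_sum i hi
  | succ t =>
    simp_rw [h.update t i hi]
    rw [← Finset.sum_div]
    exact div_self (Finset.sum_pos (fun θ _ => mul_pos (likelihood_pos hℓ s _ i θ)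
      (Real.exp_pos _)) Finset.univ_nonempty).ne'

/-- The normalising sum is common to both hypotheses and cancels. -/
theorem IsExecution.log_ratio_succ {V Θ : Type*} [Fintype V] [Fintype Θ] {S : V → Type*}
    [∀ i, Fintype (S i)] {G : Digraph V} {f : ℕ} {F : Finset V} {ℓ : ∀ i, Θ → S i → ℝ}
    {s : ℕ → ∀ i, S i} {msg : ℕ → V → V → Θ → ℝ} {η μ : ℕ → V → Θ → ℝ}
    (h : IsExecution G f F ℓ s msg η μ) (hℓ : IsSignalModel ℓ) (t : ℕ) {i : V} (hi : i ∉ F)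
    (θ θ' : Θ) : Real.log (μ (t + 1) i θ / μ (t + 1) i θ') =
      η (t + 1) i θ - η (t + 1) i θ' +
        Real.log (likelihood ℓ s (t + 1) i θ / likelihood ℓ s (t + 1) i θ') := by
  have hl := fun θ => (likelihood_pos hℓ s (t + 1) i θ).ne'
  have hμ := h.belief_pos hℓ (t + 1) hi θ'
  rw [h.update t i hi θ, h.update t i hi θ']
  rw [h.update t i hi θ'] at hμ
  have hZ : ∑ θ', likelihood ℓ s (t + 1) i θ' * Real.exp (η (t + 1) i θ') ≠ 0 := fun h0 => by
    simp [h0] at hμ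
  rw [div_div_div_cancel_right₀ hZ, Real.log_div (mul_ne_zero (hl θ) (Real.exp_ne_zero _))
    (mul_ne_zero (hl θ') (Real.exp_ne_zero _)), Real.log_mul (hl θ) (Real.exp_ne_zero _),
    Real.log_mul (hl θ') (Real.exp_ne_zero _), Real.log_div (hl θ) (hl θ'), Real.log_exp,
    Real.log_exp]
  ring

/-- In every iteration the non-faulty agents average their log-ratios with weights that are
bounded below along a reduced graph. -/
theorem IsExecution.exists_averaging {V Θ : Type*} [Fintype V] [DecidableEq V] [Fintype Θ]
    {S : V → Type*} [∀ i, Fintype (S i)] {G : Digraph V} {f : ℕ} {F : Finset V} {ℓ : ∀ i, Θ → S i → ℝ}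
    {s : ℕ → ∀ i, S i} {msg : ℕ → V → V → Θ → ℝ} {η μ : ℕ → V → Θ → ℝ}
    (h : IsExecution G f F ℓ s msg η μ) (hℓ : IsSignalModel ℓ)
    (hG : UniqueSource G f (Fintype.card Θ)) (hF : F.card ≤ f) (θ θ' : Θ) (t : ℕ) :
    ∃ A : {v // v ∉ F} → {v // v ∉ F} → ℝ, (∀ i j, 0 ≤ A i j) ∧ (∀ i, ∑ j, A i j = 1) ∧
      (∀ i, minWeight (Fintype.card V) f ≤ A i i) ∧
      (∃ H : Digraph {v // v ∉ F}, IsReducedGraph G (Fintype.card Θ * f) F H ∧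
        ∀ u v, u ≠ v → H.Adj u v → minWeight (Fintype.card V) f ≤ A v u) ∧
      ∀ i : {v // v ∉ F}, Real.log (μ (t + 1) i θ / μ (t + 1) i θ') =
        ∑ j, A i j * Real.log (μ t j θ / μ t j θ') +
          Real.log (likelihood ℓ s (t + 1) i θ / likelihood ℓ s (t + 1) i θ') := by
  have hex : ∀ i : {v // v ∉ F}, _ := fun i =>
    OneIter.exists_weights (x := fun j θ => Real.log (μ t j θ)) (Fintype.card_pos_iff.2 ⟨θ⟩) hG
      hF i.2 (fun j hj hji => h.send t j hj i hji) (h.consensus t i i.2)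
  choose a ha0 haF ha1 hay hai hacard using hex
  have hsub : ∀ g : V → ℝ, (∀ j ∈ F, g j = 0) → ∑ j : {v // v ∉ F}, g j = ∑ j, g j := by
    intro g hg
    rw [← Finset.sum_subtype (Finset.univ.filter (· ∉ F)) (by simp) g, Finset.sum_filter]
    refine Finset.sum_congr rfl fun j _ => ?_
    split_ifs with hj
    · exact (hg j hj).symm
    · rfl
  -- Self-loops of `G` are kept whatever their weight, so only light in-neighbours count as deleted
  -- links.
  refine ⟨fun i j => a i j, fun i j => ha0 i j, fun i => ?_, hai, ⟨⟨fun u v => G.Adj u v ∧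
    (u ≠ v → minWeight (Fintype.card V) f ≤ a v u)⟩, ⟨fun u v h => h.1, fun v => ?_⟩,
    fun u v huv h => h.2 huv⟩, fun i => ?_⟩
  · rw [hsub (a i) (haF i), ha1]
  · refine le_trans ?_ (hacard v)
    rw [← Set.ncard_image_of_injective _ Subtype.val_injective]
    refine Set.ncard_le_ncard ?_ (Set.toFinite _)
    rintro _ ⟨u, ⟨hu1, hu2⟩, rfl⟩
    simp only [not_and, hu1, true_implies] at hu2
    push Not at hu2
    exact ⟨u.2, mem_inNeighbors.2 ⟨fun h => hu2.1 (Subtype.ext h), hu1⟩, hu2.2⟩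
  · rw [h.log_ratio_succ hℓ t i.2, hay i, hsub (fun j => a i j * Real.log (μ t j θ / μ t j θ'))
      fun j hj => by simp [haF i j hj]]
    simp only [Finset.sum_apply, Pi.smul_apply, smul_eq_mul]
    rw [← Finset.sum_sub_distrib]
    congr 1
    refine Finset.sum_congr rfl fun j _ => ?_
    by_cases hj : j ∈ F
    · simp [haF i j hj]
    · rw [Real.log_div (h.belief_pos hℓ t hj θ).ne' (h.belief_pos hℓ t hj θ').ne', mul_sub]

/-- An execution whose log-likelihood ratios obey the law of large numbers learns at a
quadratic rate. -/
theorem IsExecution.eventually_log_ratio_le {V Θ : Type*} [Fintype V] [Fintype Θ]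
    {S : V → Type*} [∀ i, Fintype (S i)] {G : Digraph V} {f : ℕ} {F : Finset V}
    {ℓ : ∀ i, Θ → S i → ℝ} {θstar : Θ} {s : ℕ → ∀ i, S i} {msg : ℕ → V → V → Θ → ℝ}
    {η μ : ℕ → V → Θ → ℝ} (h : IsExecution G f F ℓ s msg η μ) (hℓ : IsSignalModel ℓ)
    (hA : Assumption G f ℓ θstar) (hF : F.card ≤ f) {θ : Θ} (hθ : θ ≠ θstar)
    (hL : ∀ i, Tendsto (fun t : ℕ =>
      Real.log (likelihood ℓ s t i θ / likelihood ℓ s t i θstar) / t) atTop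
      (𝓝 (-klDivergence (ℓ i θstar) (ℓ i θ)))) :
    ∀ᶠ t : ℕ in atTop, ∀ i, i ∉ F → Real.log (μ t i θ / μ t i θstar) ≤
      -(minWeight (Fintype.card V) f ^ Fintype.card V / (16 * (Fintype.card V + 1) ^ 2) *
        detectionCapability G f ℓ θstar) * (t : ℝ) ^ 2 := by
  classical
  have hcap := detectionCapability_pos hθ hℓ hA
  have hN : (0 : ℝ) < Fintype.card V + 1 := by positivity
  choose A hA0 hA1 hAd hAH hAψ using h.exists_averaging hℓ hA.unique_source hF θ θstar
  have key := eventually_le_of_averaging (Fintype.card_subtype_le fun v => v ∉ F) A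
    (minWeight_pos (Fintype.card V) f) (div_pos hcap hN) hA0 hA1 hAd
    (fun j => klDivergence (ℓ j θstar) (ℓ j θ))
    (fun j => klDivergence_nonneg (hℓ.pos j _) (hℓ.pos j _) (hℓ.sum_eq_one j _)
      (hℓ.sum_eq_one j _)) ?_ (fun t j => Real.log (μ t j θ / μ t j θstar))
    (fun t j => Real.log (likelihood ℓ s t j θ / likelihood ℓ s t j θstar)) hAψ
    (fun j => hL j)
  · filter_upwards [key] with t ht i hi
    refine (ht ⟨i, hi⟩).trans_eq ?_
    congr 2
    field_simp
  · rintro t X hX ⟨v, hv⟩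
    obtain ⟨H, hH, hHA⟩ := hAH t
    obtain ⟨C, hC, -⟩ := hA.unique_source F hF H hH
    -- At most `N` divergences sum to at least `C_1 > 0`, so one of them is at least `C_1 / (N +
    -- 1)`.
    obtain ⟨j, hjC, hj⟩ : ∃ j ∈ C, detectionCapability G f ℓ θstar / (Fintype.card V + 1) ≤
        klDivergence (ℓ j θstar) (ℓ j θ) := by
      by_contra! hlt
      have h1 := detectionCapability_le hθ hF hH hC hℓ
      have h2 := Finset.sum_le_sum fun j hj => (hlt j hj).le
      have hCV : (C.card : ℝ) ≤ Fintype.card V := by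
        exact_mod_cast (Finset.card_le_univ C).trans (Fintype.card_subtype_le _)
      have h3 := h1.trans h2
      rw [Finset.sum_const, nsmul_eq_mul, mul_div_assoc', le_div_iff₀ hN] at h3
      nlinarith
    obtain ⟨u, hu, w, hw, huw⟩ := exists_adj_leaving H (hX j hj) hv
      (hA.unique_source.reaches hF hH hC hjC v)
    exact ⟨u, hu, w, hw, hHA u w (fun h => hw (h ▸ hu)) huw⟩

end BFL

-- The main theorem

theorem mainTheorem1 {V Θ : Type*} [Fintype V] [Fintype Θ] (G : Digraph V) (f : ℕ) :
    ∃ κ : ℝ, 0 < κ ∧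
      ∀ (S : V → Type*) [∀ i, Fintype (S i)] [∀ i, MeasurableSpace (S i)]
        [∀ i, MeasurableSingletonClass (S i)]
        (ℓ : ∀ i, Θ → S i → ℝ) (θstar : Θ)
        (Ω : Type*) [MeasurableSpace Ω] (P : Measure Ω) [IsProbabilityMeasure P]
        (s : ℕ → ∀ i, Ω → S i)
        (F : Finset V)
        (msg : Ω → ℕ → V → V → Θ → ℝ) (η μ : Ω → ℕ → V → Θ → ℝ),
        BFL.IsSignalModel ℓ →
        BFL.Assumption G f ℓ θstar →
        BFL.IsSignalProcess P ℓ θstar s →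
        F.card ≤ f →
        (∀ ω, BFL.IsExecution G f F ℓ (fun t i => s t i ω) (msg ω) (η ω) (μ ω)) →
        ∀ i, i ∉ F → ∀ θ, θ ≠ θstar →
          0 < BFL.detectionCapability G f ℓ θstar ∧
          ∀ᵐ ω ∂P,
            Tendsto (fun t => μ ω t i θ) atTop (𝓝 0) ∧
            Tendsto (fun t => Real.log (μ ω t i θ / μ ω t i θstar)) atTop atBot ∧
            ∀ᶠ t : ℕ in atTop, Real.log (μ ω t i θ / μ ω t i θstar) ≤
              -(κ * BFL.detectionCapability G f ℓ θstar) * (t : ℝ) ^ 2 := by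
  have hN : (0 : ℝ) < Fintype.card V + 1 := by positivity
  have hβ := BFL.minWeight_pos (Fintype.card V) f
  -- One factor `N + 1` is the block length, the other the pigeonhole loss inside a source
  -- component.
  have hκ : 0 < BFL.minWeight (Fintype.card V) f ^ Fintype.card V /
      (16 * ((Fintype.card V : ℝ) + 1) ^ 2) := by positivity
  refine ⟨_, hκ, ?_⟩
  intro S _ _ _ ℓ θstar Ω _ P _ s F msg η μ hℓ hA hs hF hex i hi θ hθ
  have hcap := BFL.detectionCapability_pos hθ hℓ hA
  refine ⟨hcap, ?_⟩
  -- The strong law for each agent is the only probabilistic input. The rest is pathwise, so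
  -- Byzantine messages may depend on `ω` arbitrarily.
  filter_upwards [ae_all_iff.2 fun j => hs.tendsto_log_likelihood hℓ j θ] with ω hω
  have hbound := (hex ω).eventually_log_ratio_le hℓ hA hF hθ hω
  have hbot : Tendsto (fun t => Real.log (μ ω t i θ / μ ω t i θstar)) atTop atBot := by
    refine tendsto_atBot_mono' atTop (hbound.mono fun t ht => ht i hi) ?_
    exact ((tendsto_pow_atTop two_ne_zero).comp
      tendsto_natCast_atTop_atTop).const_mul_atTop_of_neg (neg_neg_of_pos (mul_pos hκ hcap))
  refine ⟨?_, hbot, hbound.mono fun t ht => ht i hi⟩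
  have hpos := fun t θ => (hex ω).belief_pos hℓ t hi θ
  have : Nonempty Θ := ⟨θ⟩
  -- Since `μ ω t i θstar ≤ 1`, the belief in `θ` is at most the ratio, the exponential of the
  -- log-ratio.
  refine squeeze_zero (fun t => (hpos t θ).le) (fun t => ?_) (Real.tendsto_exp_atBot.comp hbot)
  have hle : μ ω t i θstar ≤ 1 := by
    rw [← (hex ω).belief_sum hℓ t hi]
    exact Finset.single_le_sum (fun θ _ => (hpos t θ).le) (Finset.mem_univ θstar)
  rw [Function.comp_apply, Real.exp_log (div_pos (hpos t θ) (hpos t θstar)),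
    le_div_iff₀ (hpos t θstar)]
  exact mul_le_of_le_one_right (hpos t θ).le hle
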